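/- **Setting.** There are $n$ agents with valuations $v=(v_1,\dots,v_n)\in[0,\infty)^n$ and $k$ identical units. A (direct, randomized) money-burning mechanism maps each bid profile $v$ to allocation probabilities $x_i(v)\in[0,1]$ with $\sum_i x_i(v)\le k$ and expected burnt payments $p_i(v)\ge 0$; its expected residual surplus on $v$ is $\sum_i (v_i x_i(v)-p_i(v))$. It is *prior-free* if it is truthful in expectation in dominant strategies and individually rational on every profile. **Benchmark.** Let $F$ be a distribution on $[0,\infty)$ with a density $f$ that is positive exactly on an interval. Put $\vartheta(z)=\frac{1-F(z)}{f(z)}$, $H(q)=\int_0^q\vartheta(F^{-1}(r))\,dr$, let $G$ be the largest convex function bounded above by $H$, let $g$ be the derivative of $G$, extended by right-continuity (and at $q=1$ by its limit from the left), and let $\bar\vartheta(z)=g(F(z))$ be the ironed virtual valuation for utility. The mechanism $\mathrm{Opt}_F$ chooses, uniformly at random, one of the sets $S$ of at most $k$ agents that maximize $\sum_{i\in S}\bar\vartheta(v_i)$; with $x_i(v)$ the resulting probability that agent $i$ is served, the expected payments are $p_i(v)=v_ix_i(v)-\int_0^{v_i}x_i(z,v_{-i})\,dz$. The benchmark is $$\mathcal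 G(v)=\sup_F \mathrm{Opt}_F(v),$$ where $\mathrm{Opt}_F(v)$ is the expected residual surplus of $\mathrm{Opt}_F$ on $v$. For $\beta>0$, a mechanism *$\beta$-approximates* $\mathcal G$ if its expected residual surplus on every profile $v$ is at least $\mathcal G(v)/\beta$. **Proposition.** Consider two agents and one unit ($n=2$, $k=1$). If a prior-free money-burning mechanism $\beta$-approximates $\mathcal G$, then $\beta\ge 4/3$. Moreover, for two agents and one unit: (a) if the valuations are i.i.d. standard exponential, then the maximum expected residual surplus over all Bayesian incentive compatible, ex interim individually rational money-burning mechanisms is attained and equals $1$; (b) for every profile with $v_1\ge v_2\ge 0$, $\mathcal G(v)=\max\{\tfrac{v_1+v_2}{2},\,v_1-\tfrac{v_2}{2}\}$ (and symmetrically for $v_2\ge v_1$); (c) if the valuations are i.i.d. standard exponential, then $\mathbb E[\mathcal G(v)]=4/3$. -/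

import Mathlib

open MeasureTheory ProbabilityTheory

noncomputable section

namespace MoneyBurning

/-! ### Money-burning mechanisms for `n` agents and `k` identical units -/

/-- A valuation (or bid) profile is a vector of nonnegative reals. -/
def IsProfile {n : ℕ} (v : Fin n → ℝ) : Prop := ∀ i, 0 ≤ v i

/-- A direct, possibly randomized, money-burning mechanism for `n` agents and `k` units.
`alloc v i` is the probability (over the coins of the mechanism) that agent `i` is served on the
bid profile `v`, and `pay v i` is the expected amount that agent `i` burns.  At most `k` agents are
served, and there are no positive transfers to the agents. -/
structure Mechanism (n k : ℕ) where
  alloc : (Fin n → ℝ) → Fin n → ℝ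
  pay : (Fin n → ℝ) → Fin n → ℝ
  measurable_alloc : ∀ i, Measurable fun v => alloc v i
  measurable_pay : ∀ i, Measurable fun v => pay v i
  alloc_nonneg : ∀ v i, 0 ≤ alloc v i
  alloc_le_one : ∀ v i, alloc v i ≤ 1
  sum_alloc_le : ∀ v, ∑ i, alloc v i ≤ k
  pay_nonneg : ∀ v i, 0 ≤ pay v i

namespace Mechanism

variable {n k : ℕ} (M : Mechanism n k)

/-- Expected residual surplus `∑ i, (v i * x i - p i)` at the profile `v`. -/
def residual (v : Fin n → ℝ) : ℝ := ∑ i, (v i * M.alloc v i - M.pay v i)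

/-- Dominant strategy incentive compatibility for risk-neutral agents
(truthfulness in expectation over the coins of the mechanism). -/
def IsTruthful : Prop :=
  ∀ v, IsProfile v → ∀ i, ∀ b : ℝ, 0 ≤ b →
    v i * M.alloc (Function.update v i b) i - M.pay (Function.update v i b) i
      ≤ v i * M.alloc v i - M.pay v i

/-- Individual rationality on every profile (in expectation over the coins). -/
def IsIR : Prop :=
  ∀ v, IsProfile v → ∀ i, 0 ≤ v i * M.alloc v i - M.pay v i

/-- Prior-free mechanisms: truthful and individually rational on every valuation profile. -/
def IsPriorFree : Prop := M.IsTruthful ∧ M.IsIR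

/-- Probability that agent `i` is served when bidding `b` while the other bids are
distributed according to `μ` (the `i`-th coordinate of the sample is overwritten by `b`). -/
def interimAlloc (μ : Measure (Fin n → ℝ)) (i : Fin n) (b : ℝ) : ℝ :=
  ∫ v, M.alloc (Function.update v i b) i ∂μ

/-- Expected payment of agent `i` when bidding `b`, the other bids being distributed
according to `μ`. -/
def interimPay (μ : Measure (Fin n → ℝ)) (i : Fin n) (b : ℝ) : ℝ :=
  ∫ v, M.pay (Function.update v i b) i ∂μ

/-- Bayesian incentive compatibility together with ex interim individual rationality, for the
product prior `μ`.  The first clause says that the interim payments are finite. -/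
def IsBayesian (μ : Measure (Fin n → ℝ)) : Prop :=
  (∀ i, ∀ b : ℝ, 0 ≤ b → Integrable (fun v => M.pay (Function.update v i b) i) μ) ∧
  (∀ i, ∀ t b : ℝ, 0 ≤ t → 0 ≤ b →
    t * M.interimAlloc μ i b - M.interimPay μ i b
      ≤ t * M.interimAlloc μ i t - M.interimPay μ i t) ∧
  (∀ i, ∀ t : ℝ, 0 ≤ t → 0 ≤ t * M.interimAlloc μ i t - M.interimPay μ i t)

end Mechanism

/-! ### Valuation distributions and ironed virtual valuations for utility -/

/-- A distribution on `[0, ∞)` given by a density that is positive exactly on an interval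
(bounded or not). -/
structure ValueDist where
  density : ℝ → ℝ
  measurable_density : Measurable density
  density_nonneg : ∀ z, 0 ≤ density z
  density_of_neg : ∀ z, z < 0 → density z = 0
  lintegral_density : ∫⁻ z, ENNReal.ofReal (density z) = 1
  ordConnected_support : (Function.support density).OrdConnected

namespace ValueDist

variable (D : ValueDist)

/-- The cumulative distribution function `F`. -/
def cdf (z : ℝ) : ℝ := ∫ x in Set.Iic z, D.density x

/-- The inverse `F⁻¹` of the distribution function. -/
def quantile (q : ℝ) : ℝ := sInf {z : ℝ | q ≤ D.cdf z}

/-- The virtual valuation for utility `(1 - F) / f`. -/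
def virtual (z : ℝ) : ℝ := (1 - D.cdf z) / D.density z

/-- `H(q) = ∫₀^q ϑ(F⁻¹(r)) dr`. -/
def cumVirtual (q : ℝ) : ℝ := ∫ r in (0 : ℝ)..q, D.virtual (D.quantile r)

/-- The largest convex function bounded above by `H`.  The interval `[0, 1)` is used since `H(1)`,
the mean of the distribution, may be infinite; if it is finite, then `H` is continuous on `[0, 1]`
and the hulls over `[0, 1)` and over `[0, 1]` agree on `[0, 1)`. -/
def hull (q : ℝ) : ℝ :=
  sSup {y : ℝ | ∃ φ : ℝ → ℝ, ConvexOn ℝ (Set.Ico 0 1) φ ∧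
    (∀ r ∈ Set.Ico (0 : ℝ) 1, φ r ≤ D.cumVirtual r) ∧ y = φ q}

/-- The derivative of the convex hull, extended by right-continuity, that is, its right derivative.
At `q = 1` there is no right derivative, and the value is the limit from the left, which
is the supremum since the derivative of a convex function is monotone. -/
def hullDeriv (q : ℝ) : EReal :=
  if q < 1 then ((derivWithin D.hull (Set.Ioi q) q : ℝ) : EReal)
  else ⨆ r ∈ Set.Ico (0 : ℝ) 1, ((derivWithin D.hull (Set.Ioi r) r : ℝ) : EReal)

/-- The ironed virtual valuation for utility. -/
def ironed (z : ℝ) : EReal := D.hullDeriv (D.cdf z)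

/-! ### The symmetric optimal mechanism of a distribution, and the benchmark -/

open Classical in
/-- The feasible allocations (sets of at most `k` served agents) that maximize the ironed virtual
surplus at `v`. -/
def optAllocs (n k : ℕ) (v : Fin n → ℝ) : Finset (Finset (Fin n)) :=
  Finset.univ.filter fun S => S.card ≤ k ∧
    ∀ T : Finset (Fin n), T.card ≤ k → ∑ i ∈ T, D.ironed (v i) ≤ ∑ i ∈ S, D.ironed (v i)

/-- The probability that agent `i` is served if one of the maximizing allocations is chosen
uniformly at random. -/
def optAlloc (n k : ℕ) (v : Fin n → ℝ) (i : Fin n) : ℝ :=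
  (((D.optAllocs n k v).filter fun S => i ∈ S).card : ℝ) / ((D.optAllocs n k v).card : ℝ)

/-- The payment identity: `pᵢ(v) = vᵢ xᵢ(v) - ∫₀^{vᵢ} xᵢ(z, v₋ᵢ) dz`. -/
def optPay (n k : ℕ) (v : Fin n → ℝ) (i : Fin n) : ℝ :=
  v i * D.optAlloc n k v i - ∫ z in (0 : ℝ)..(v i), D.optAlloc n k (Function.update v i z) i

/-- Expected residual surplus, on the profile `v`, of the symmetric optimal mechanism for `D`. -/
def optResidual (n k : ℕ) (v : Fin n → ℝ) : ℝ :=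
  ∑ i, (v i * D.optAlloc n k v i - D.optPay n k v i)

end ValueDist

/-- The benchmark `𝒢(v)`: the supremum over all i.i.d. distributions of the residual surplus on `v`
of the symmetric optimal mechanism.  (For a profile `v` the set is bounded by `∑ i, v i`.) -/
def benchmark (n k : ℕ) (v : Fin n → ℝ) : ℝ := ⨆ D : ValueDist, D.optResidual n k v

/-- The mechanism `M` `β`-approximates the benchmark. -/
def Mechanism.Approximates {n k : ℕ} (M : Mechanism n k) (β : ℝ) : Prop :=
  0 < β ∧ ∀ v, IsProfile v → benchmark n k v / β ≤ M.residual v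

/-- The law of two independent standard exponential valuations. -/
def expPrior : Measure (Fin 2 → ℝ) := Measure.pi fun _ => expMeasure 1

end MoneyBurning

end

namespace MoneyBurning

/-! The bound `4 / 3` comes from averaging over independent standard exponential values: the
benchmark then has mean `4 / 3`, while every prior-free mechanism, being Bayesian for this prior,
has expected residual surplus at most `1`.

The bound `1` rests on two facts. By incentive compatibility and nonnegative payments, the interim
utility of type `t` is at most the integral of the interim allocation over `[0, t]`
(`utility_le_integral_alloc`). Since the exponential tail equals its density, the mean of that
integral is the mean of the allocation itself (`integral_expMeasure_primitive`). So the expected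
surplus is at most the expected number of units handed out, and a free fair lottery attains `1`.

For the benchmark, ironed virtual values are monotone and nonnegative, so an optimal mechanism
either separates the two values or does not. Bounding the areas under the allocation curves in these
two cases gives the two terms of the maximum (`optResidual_le`). Both are reached, the second as a
limit, by distributions whose hazard rate drops from `1` to `1/2` at a threshold `a`: their virtual
value is `1` below `a` and `2` above, and needs no ironing (`twoRate_ironed`). The mean follows by
writing the benchmark as the lottery surplus plus two positive parts of mean `1/6` each. -/

/-- The integral of a function with two values, taken on two adjacent intervals. -/
lemma integral_two_step {f : ℝ → ℝ} {a t b c : ℝ} (ha : 0 ≤ a) (hat : a ≤ t)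
    (hb : ∀ z ∈ Set.Ioo 0 a, f z = b) (hc : ∀ z ∈ Set.Ioo a t, f z = c) :
    IntervalIntegrable f volume 0 t ∧ ∫ z in (0 : ℝ)..t, f z = b * a + c * (t - a) := by
  have hb' : Set.EqOn (fun _ => b) f (Set.uIoo 0 a) := fun z hz =>
    (hb z (by rwa [Set.uIoo_of_le ha] at hz)).symm
  have hc' : Set.EqOn (fun _ => c) f (Set.uIoo a t) := fun z hz =>
    (hc z (by rwa [Set.uIoo_of_le hat] at hz)).symm
  have ib : IntervalIntegrable f volume 0 a := intervalIntegrable_const.congr_uIoo hb'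
  have ic : IntervalIntegrable f volume a t := intervalIntegrable_const.congr_uIoo hc'
  refine ⟨ib.trans ic, ?_⟩
  rw [← intervalIntegral.integral_add_adjacent_intervals ib ic,
    ← intervalIntegral.integral_congr_uIoo hb', ← intervalIntegral.integral_congr_uIoo hc']
  simp [mul_comm]

/-! ### Distribution functions, the convex hull and monotonicity of ironed values. -/

namespace ValueDist

variable (D : ValueDist)

lemma integrable_density : Integrable D.density := by
  refine ⟨D.measurable_density.aestronglyMeasurable, ?_⟩
  rw [hasFiniteIntegral_iff_ofReal (Filter.Eventually.of_forall D.density_nonneg),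
    D.lintegral_density]
  exact ENNReal.one_lt_top

lemma integral_density : ∫ z, D.density z = 1 := by
  rw [integral_eq_lintegral_of_nonneg_ae (Filter.Eventually.of_forall D.density_nonneg)
    D.measurable_density.aestronglyMeasurable, D.lintegral_density, ENNReal.toReal_one]

lemma cdf_nonneg (z : ℝ) : 0 ≤ D.cdf z :=
  integral_nonneg D.density_nonneg

lemma cdf_le_one (z : ℝ) : D.cdf z ≤ 1 := by
  rw [← D.integral_density]
  exact setIntegral_le_integral D.integrable_density
    (Filter.Eventually.of_forall D.density_nonneg)

lemma cdf_mono : Monotone D.cdf := fun _ _ h =>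
  setIntegral_mono_set D.integrable_density.integrableOn
    (Filter.Eventually.of_forall D.density_nonneg) (Set.Iic_subset_Iic.2 h).eventuallyLE

lemma virtual_nonneg (z : ℝ) : 0 ≤ D.virtual z :=
  div_nonneg (sub_nonneg.2 (D.cdf_le_one z)) (D.density_nonneg z)

lemma cumVirtual_nonneg {r : ℝ} (hr : 0 ≤ r) : 0 ≤ D.cumVirtual r :=
  intervalIntegral.integral_nonneg hr fun _ _ => D.virtual_nonneg _

lemma le_hull {φ : ℝ → ℝ} (hφ : ConvexOn ℝ (Set.Ico 0 1) φ)
    (h : ∀ r ∈ Set.Ico (0 : ℝ) 1, φ r ≤ D.cumVirtual r) {q : ℝ} (hq : q ∈ Set.Ico (0 : ℝ) 1) :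
    φ q ≤ D.hull q :=
  le_csSup ⟨D.cumVirtual q, by rintro _ ⟨ψ, -, hψ, rfl⟩; exact hψ q hq⟩ ⟨φ, hφ, h, rfl⟩

lemma hull_le {q y : ℝ} (hy : ∀ φ : ℝ → ℝ, ConvexOn ℝ (Set.Ico 0 1) φ →
    (∀ r ∈ Set.Ico (0 : ℝ) 1, φ r ≤ D.cumVirtual r) → φ q ≤ y) : D.hull q ≤ y := by
  refine csSup_le ⟨_, fun _ => 0, convexOn_const 0 (convex_Ico 0 1),
    fun r hr => D.cumVirtual_nonneg hr.1, rfl⟩ ?_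
  rintro _ ⟨φ, hφ, h, rfl⟩
  exact hy φ hφ h

lemma hull_nonneg {q : ℝ} (hq : q ∈ Set.Ico (0 : ℝ) 1) : 0 ≤ D.hull q :=
  D.le_hull (convexOn_const 0 (convex_Ico 0 1)) (fun _ hr => D.cumVirtual_nonneg hr.1) hq

lemma hull_zero : D.hull 0 = 0 := by
  refine le_antisymm (D.hull_le fun φ _ h => ?_) (D.hull_nonneg (by simp))
  simpa [cumVirtual] using h 0 (by simp)

/-- A pointwise supremum of convex minorants is convex. -/
lemma convexOn_hull : ConvexOn ℝ (Set.Ico 0 1) D.hull := by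
  refine ⟨convex_Ico 0 1, fun x hx y hy a b ha hb hab => D.hull_le fun φ hφ h => ?_⟩
  refine (hφ.2 hx hy ha hb hab).trans ?_
  simp only [smul_eq_mul]
  gcongr
  · exact D.le_hull hφ h hx
  · exact D.le_hull hφ h hy

/-- If `H` is convex, no ironing takes place. -/
lemma hull_eq_cumVirtual (h : ConvexOn ℝ (Set.Ico 0 1) D.cumVirtual) {q : ℝ}
    (hq : q ∈ Set.Ico (0 : ℝ) 1) : D.hull q = D.cumVirtual q :=
  le_antisymm (D.hull_le fun _ _ hφ => hφ q hq) (D.le_hull h (fun _ _ => le_rfl) hq)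

/-- The right derivative of the hull. -/
noncomputable def hullRightDeriv (q : ℝ) : ℝ := derivWithin D.hull (Set.Ioi q) q

lemma slope_hull_le_hullRightDeriv {x q : ℝ} (hx : 0 ≤ x) (hxq : x < q) (hq : q < 1) :
    slope D.hull x q ≤ D.hullRightDeriv q := by
  have hi : q ∈ interior (Set.Ico (0 : ℝ) 1) := by
    rw [interior_Ico]; exact ⟨hx.trans_lt hxq, hq⟩
  exact (D.convexOn_hull.slope_le_leftDeriv_of_mem_interior ⟨hx, hxq.trans hq⟩ hi hxq).trans
    (D.convexOn_hull.leftDeriv_le_rightDeriv_of_mem_interior hi)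

lemma slope_hull_zero_nonneg {q : ℝ} (hq0 : 0 < q) (hq : q < 1) : 0 ≤ slope D.hull 0 q := by
  rw [slope_def_field, D.hull_zero, sub_zero, sub_zero]
  exact div_nonneg (D.hull_nonneg ⟨hq0.le, hq⟩) hq0.le

lemma hullRightDeriv_nonneg {q : ℝ} (hq0 : 0 ≤ q) (hq : q < 1) : 0 ≤ D.hullRightDeriv q := by
  rcases hq0.eq_or_lt with rfl | h
  · by_cases hd : DifferentiableWithinAt ℝ D.hull (Set.Ioi 0) 0
    · have := hd.hasDerivWithinAt
      rw [hasDerivWithinAt_iff_tendsto_slope' (by simp)] at this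
      refine ge_of_tendsto this ?_
      filter_upwards [Ioo_mem_nhdsGT (show (0 : ℝ) < 1 by norm_num)] with x hx
      exact D.slope_hull_zero_nonneg hx.1 hx.2
    -- The default value `0` of `derivWithin` satisfies the bound too, so existence of the right
    -- derivative at the endpoint need not be shown.
    · exact (derivWithin_zero_of_not_differentiableWithinAt hd).ge
  · exact (D.slope_hull_zero_nonneg h hq).trans (D.slope_hull_le_hullRightDeriv le_rfl h hq)

/-- The slope of the chord from `q` to `r` separates the two derivatives. Where `derivWithin`
defaults to `0`, nonnegativity takes over. -/
lemma hullRightDeriv_mono {q r : ℝ} (hq : 0 ≤ q) (hqr : q ≤ r) (hr : r < 1) :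
    D.hullRightDeriv q ≤ D.hullRightDeriv r := by
  rcases hqr.eq_or_lt with rfl | h
  · rfl
  by_cases hd : DifferentiableWithinAt ℝ D.hull (Set.Ioi q) q
  · exact (D.convexOn_hull.rightDeriv_le_slope ⟨hq, h.trans hr⟩ ⟨hq.trans hqr, hr⟩ h hd).trans
      (D.slope_hull_le_hullRightDeriv hq h hr)
  · refine (derivWithin_zero_of_not_differentiableWithinAt hd).le.trans ?_
    exact D.hullRightDeriv_nonneg (hq.trans hqr) hr

lemma hullDeriv_of_lt {q : ℝ} (hq : q < 1) : D.hullDeriv q = (D.hullRightDeriv q : EReal) :=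
  if_pos hq

lemma hullDeriv_mono {q r : ℝ} (hq : 0 ≤ q) (hqr : q ≤ r) :
    D.hullDeriv q ≤ D.hullDeriv r := by
  by_cases h : r < 1
  · rw [D.hullDeriv_of_lt h, D.hullDeriv_of_lt (hqr.trans_lt h)]
    exact EReal.coe_le_coe_iff.2 (D.hullRightDeriv_mono hq hqr h)
  · by_cases h' : q < 1
    · rw [D.hullDeriv_of_lt h', hullDeriv, if_neg h]
      exact le_iSup₂_of_le (f := fun (r : ℝ) (_ : r ∈ Set.Ico (0 : ℝ) 1) =>
        ((derivWithin D.hull (Set.Ioi r) r : ℝ) : EReal)) q ⟨hq, h'⟩ le_rfl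
    · rw [hullDeriv, hullDeriv, if_neg h, if_neg h']

lemma ironed_mono : Monotone D.ironed := fun z _ h =>
  D.hullDeriv_mono (D.cdf_nonneg z) (D.cdf_mono h)

lemma ironed_nonneg (z : ℝ) : 0 ≤ D.ironed z := by
  refine le_trans ?_ (D.hullDeriv_mono le_rfl (D.cdf_nonneg z))
  rw [D.hullDeriv_of_lt one_pos]
  exact EReal.coe_nonneg.2 (D.hullRightDeriv_nonneg le_rfl one_pos)

/-! ### Two agents and one unit -/

lemma mem_optAllocs_two_one {v : Fin 2 → ℝ} {S : Finset (Fin 2)} :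
    S ∈ D.optAllocs 2 1 v ↔ (S = ∅ ∧ ∀ j, D.ironed (v j) ≤ 0) ∨
      ∃ i, S = {i} ∧ ∀ j, D.ironed (v j) ≤ D.ironed (v i) := by
  simp only [optAllocs, Finset.mem_filter, Finset.mem_univ, true_and,
    Finset.card_le_one_iff_subset_singleton]
  constructor
  · rintro ⟨⟨i, hi⟩, h⟩
    have h' : ∀ j, D.ironed (v j) ≤ ∑ i ∈ S, D.ironed (v i) := fun j => by
      simpa using h {j} ⟨j, subset_rfl⟩
    rcases Finset.subset_singleton_iff.1 hi with rfl | rfl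
    · exact Or.inl ⟨rfl, by simpa using h'⟩
    · exact Or.inr ⟨i, rfl, by simpa using h'⟩
  · rintro (⟨rfl, h⟩ | ⟨i, rfl, h⟩)
    · refine ⟨⟨0, by simp⟩, ?_⟩
      rintro T ⟨j, hj⟩
      rcases Finset.subset_singleton_iff.1 hj with rfl | rfl
      · simp
      · simpa using h j
    · refine ⟨⟨i, by simp⟩, ?_⟩
      rintro T ⟨j, hj⟩
      rcases Finset.subset_singleton_iff.1 hj with rfl | rfl
      · simpa using D.ironed_nonneg _
      · simpa using h j

lemma optAlloc_nonneg {n k : ℕ} (v : Fin n → ℝ) (i : Fin n) : 0 ≤ D.optAlloc n k v i :=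
  div_nonneg (Nat.cast_nonneg _) (Nat.cast_nonneg _)

lemma optAlloc_le_one {n k : ℕ} (v : Fin n → ℝ) (i : Fin n) : D.optAlloc n k v i ≤ 1 :=
  div_le_one_of_le₀ (by exact_mod_cast Finset.card_filter_le _ _) (Nat.cast_nonneg _)

/-- An agent whose ironed virtual value is beaten is not served. -/
lemma optAlloc_eq_zero {v : Fin 2 → ℝ} {i j : Fin 2} (h : D.ironed (v i) < D.ironed (v j)) :
    D.optAlloc 2 1 v i = 0 := by
  rw [optAlloc, Finset.filter_eq_empty_iff.2, Finset.card_empty, Nat.cast_zero, zero_div]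
  intro S hS hiS
  rcases D.mem_optAllocs_two_one.1 hS with ⟨rfl, -⟩ | ⟨l, rfl, hl⟩
  · simp at hiS
  · rw [Finset.mem_singleton] at hiS
    subst hiS
    exact (hl j).not_gt h

/-- An agent with the strictly larger ironed virtual value is served. -/
lemma optAlloc_eq_one {v : Fin 2 → ℝ} {i j : Fin 2} (h : D.ironed (v j) < D.ironed (v i)) :
    D.optAlloc 2 1 v i = 1 := by
  have hij : i ≠ j := by rintro rfl; exact h.false
  have hall : ∀ l, l = i ∨ l = j := by
    intro l; fin_cases i <;> fin_cases j <;> fin_cases l <;> simp_all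
  have : D.optAllocs 2 1 v = {{i}} := by
    ext S
    rw [D.mem_optAllocs_two_one, Finset.mem_singleton]
    constructor
    · rintro (⟨rfl, h0⟩ | ⟨l, rfl, hl⟩)
      · exact absurd ((h0 i).trans (D.ironed_nonneg _)) h.not_ge
      · rcases hall l with rfl | rfl
        · rfl
        · exact absurd (hl i) h.not_ge
    · rintro rfl
      refine Or.inr ⟨i, rfl, fun l => ?_⟩
      rcases hall l with rfl | rfl
      · rfl
      · exact h.le
  simp [optAlloc, this, Finset.filter_singleton]

/-- An agent with the weakly smaller ironed virtual value is served with probability at most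
`1/2`. -/
lemma optAlloc_le_half {v : Fin 2 → ℝ} {i j : Fin 2} (hij : i ≠ j)
    (h : D.ironed (v i) ≤ D.ironed (v j)) : D.optAlloc 2 1 v i ≤ 1 / 2 := by
  rcases h.lt_or_eq with h | h
  · rw [D.optAlloc_eq_zero h]; norm_num
  have hall : ∀ l, l = i ∨ l = j := by
    intro l; fin_cases i <;> fin_cases j <;> fin_cases l <;> simp_all
  have hle : ∀ l, D.ironed (v l) = D.ironed (v i) := fun l => by
    rcases hall l with rfl | rfl
    · rfl
    · exact h.symm
  have hmem : ∀ l, {l} ∈ D.optAllocs 2 1 v := fun l =>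
    D.mem_optAllocs_two_one.2 (Or.inr ⟨l, rfl, fun m => by rw [hle, hle l]⟩)
  have hnum : ((D.optAllocs 2 1 v).filter fun S => i ∈ S) = {{i}} := by
    ext S
    rw [Finset.mem_filter, Finset.mem_singleton]
    constructor
    · rintro ⟨hS, hi⟩
      rcases D.mem_optAllocs_two_one.1 hS with ⟨rfl, -⟩ | ⟨l, rfl, hl⟩
      · simp at hi
      · rw [Finset.mem_singleton.1 hi]
    · rintro rfl
      exact ⟨hmem i, by simp⟩
  -- Only an inequality is claimed: if both ironed values are `0`, the empty set is a third
  -- maximizer and the probability is `1/3`.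
  have hden : 2 ≤ (D.optAllocs 2 1 v).card := by
    refine (Finset.card_pair (show ({i} : Finset (Fin 2)) ≠ {j} by simpa using hij)).ge.trans
      (Finset.card_le_card fun S hS => ?_)
    rcases Finset.mem_insert.1 hS with rfl | hS
    · exact hmem i
    · rw [Finset.mem_singleton.1 hS]; exact hmem j
  rw [optAlloc, hnum, Finset.card_singleton, Nat.cast_one]
  exact one_div_le_one_div_of_le two_pos (by exact_mod_cast hden)

/-- Agents with the same positive ironed virtual value are served with probability `1/2`. -/
lemma optAlloc_eq_half {v : Fin 2 → ℝ} {i j : Fin 2} (hij : i ≠ j)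
    (h : D.ironed (v i) = D.ironed (v j)) (hpos : 0 < D.ironed (v i)) :
    D.optAlloc 2 1 v i = 1 / 2 := by
  have hall : ∀ l, l = i ∨ l = j := by
    intro l; fin_cases i <;> fin_cases j <;> fin_cases l <;> simp_all
  have : D.optAllocs 2 1 v = {{i}, {j}} := by
    ext S
    rw [D.mem_optAllocs_two_one, Finset.mem_insert, Finset.mem_singleton]
    constructor
    · rintro (⟨rfl, h0⟩ | ⟨l, rfl, hl⟩)
      · exact absurd (h0 i) hpos.not_ge
      · rcases hall l with rfl | rfl <;> simp
    · have : ∀ l m, D.ironed (v l) = D.ironed (v m) := fun l m => by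
        rcases hall l with rfl | rfl <;> rcases hall m with rfl | rfl <;> simp [h]
      rintro (rfl | rfl)
      · exact Or.inr ⟨i, rfl, fun l => (this l i).le⟩
      · exact Or.inr ⟨j, rfl, fun l => (this l j).le⟩
  have hne : ({i} : Finset (Fin 2)) ≠ {j} := by simpa using hij
  rw [optAlloc, this, Finset.card_pair hne, Finset.filter_insert, Finset.filter_singleton]
  simp [hij]

lemma optResidual_eq (n k : ℕ) (v : Fin n → ℝ) : D.optResidual n k v =
    ∑ i, ∫ z in (0 : ℝ)..(v i), D.optAlloc n k (Function.update v i z) i := by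
  simp [optResidual, optPay]

lemma intervalIntegral_optAlloc_le {n k : ℕ} {v : Fin n → ℝ} {i : Fin n} {a t b c : ℝ}
    (ha : 0 ≤ a) (hat : a ≤ t)
    (hb : ∀ z ∈ Set.Ioc 0 a, D.optAlloc n k (Function.update v i z) i ≤ b)
    (hc : ∀ z ∈ Set.Ioc a t, D.optAlloc n k (Function.update v i z) i ≤ c) :
    ∫ z in (0 : ℝ)..t, D.optAlloc n k (Function.update v i z) i ≤ b * a + c * (t - a) := by
  obtain ⟨hint, heq⟩ := integral_two_step (f := fun z => if z ≤ a then b else c) ha hat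
    (fun z hz => if_pos hz.2.le) (fun z hz => if_neg hz.1.not_ge)
  rw [← heq, intervalIntegral.integral_of_le (ha.trans hat),
    intervalIntegral.integral_of_le (ha.trans hat)]
  -- This comparison asks integrability of the dominating step function only, so measurability of
  -- the allocation in the bid is not needed.
  refine integral_mono_of_nonneg (Filter.Eventually.of_forall fun z => D.optAlloc_nonneg _ _)
    hint.1 ?_
  filter_upwards [ae_restrict_mem measurableSet_Ioc] with z hz
  split_ifs with h
  · exact hb z ⟨hz.1, h⟩
  · exact hc z ⟨not_le.1 h, hz.2⟩

lemma optResidual_two_one {i j : Fin 2} (hij : i ≠ j) (v : Fin 2 → ℝ) : D.optResidual 2 1 v =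
    (∫ z in (0 : ℝ)..(v i), D.optAlloc 2 1 (Function.update v i z) i) +
      ∫ z in (0 : ℝ)..(v j), D.optAlloc 2 1 (Function.update v j z) j := by
  rw [D.optResidual_eq, Fin.sum_univ_two]
  fin_cases i <;> fin_cases j <;> simp_all [add_comm]

/-- The residual surplus of `Opt_F` when agent `i` has the larger value. -/
lemma optResidual_le {v : Fin 2 → ℝ} (hv : IsProfile v) {i j : Fin 2} (hij : i ≠ j)
    (h : v j ≤ v i) :
    D.optResidual 2 1 v ≤ max ((v i + v j) / 2) (v i - v j / 2) := by
  rw [D.optResidual_two_one hij]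
  -- If the ironed values differ, agent `j` never wins with a bid up to `v j`, and agent `i` wins at
  -- most half the time with such a bid. If they agree, neither agent wins more than half the time
  -- with a bid up to its own value.
  rcases (D.ironed_mono h).lt_or_eq with hlt | heq
  · refine le_max_of_le_right ?_
    have h1 : ∫ z in (0 : ℝ)..(v i), D.optAlloc 2 1 (Function.update v i z) i
        ≤ 1 / 2 * v j + 1 * (v i - v j) := by
      refine D.intervalIntegral_optAlloc_le (hv j) h (fun z hz => D.optAlloc_le_half hij ?_)
        fun z _ => D.optAlloc_le_one _ _
      simpa [hij.symm] using D.ironed_mono hz.2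
    have h2 : ∫ z in (0 : ℝ)..(v j), D.optAlloc 2 1 (Function.update v j z) j
        ≤ 0 * v j + 0 * (v j - v j) := by
      refine D.intervalIntegral_optAlloc_le (hv j) le_rfl
        (fun z hz => (D.optAlloc_eq_zero (j := i) ?_).le) fun z hz => (hz.1.not_ge hz.2).elim
      simpa [hij] using (D.ironed_mono hz.2).trans_lt hlt
    linarith
  · refine le_max_of_le_left ?_
    have h1 : ∫ z in (0 : ℝ)..(v i), D.optAlloc 2 1 (Function.update v i z) i
        ≤ 1 / 2 * v i + 0 * (v i - v i) := by
      refine D.intervalIntegral_optAlloc_le (hv i) le_rfl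
        (fun z hz => D.optAlloc_le_half hij ?_) fun z hz => (hz.1.not_ge hz.2).elim
      simpa [hij.symm] using (D.ironed_mono hz.2).trans heq.ge
    have h2 : ∫ z in (0 : ℝ)..(v j), D.optAlloc 2 1 (Function.update v j z) j
        ≤ 1 / 2 * v j + 0 * (v j - v j) := by
      refine D.intervalIntegral_optAlloc_le (hv j) le_rfl
        (fun z hz => D.optAlloc_le_half hij.symm ?_) fun z hz => (hz.1.not_ge hz.2).elim
      simpa [hij] using (D.ironed_mono hz.2).trans heq.le
    linarith

end ValueDist

/-! ### A distribution whose hazard rate drops from `1` to `1/2` at a given value -/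

/-- The density of the distribution with hazard rate `1` on `(0, a)` and `1/2` on `[a, ∞)`. -/
noncomputable def twoRateDensity (a z : ℝ) : ℝ :=
  if z ≤ 0 then 0 else if z < a then Real.exp (-z) else 1 / 2 * Real.exp (-(a + z) / 2)

/-- The probability of a value above `z ≥ 0`. -/
noncomputable def twoRateTail (a z : ℝ) : ℝ :=
  if z < a then Real.exp (-z) else Real.exp (-(a + z) / 2)

lemma measurable_twoRateDensity (a : ℝ) : Measurable (twoRateDensity a) := by
  unfold twoRateDensity
  refine Measurable.ite measurableSet_Iic measurable_const
    (Measurable.ite measurableSet_Iio ?_ ?_) <;> fun_prop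

lemma twoRateDensity_nonneg (a z : ℝ) : 0 ≤ twoRateDensity a z := by
  unfold twoRateDensity
  split_ifs <;> positivity

lemma twoRateDensity_tail_of_le {a z : ℝ} (ha : 0 < a) (hz : a ≤ z) :
    IntegrableOn (twoRateDensity a) (Set.Ioi z) ∧
      ∫ x in Set.Ioi z, twoRateDensity a x = Real.exp (-(a + z) / 2) := by
  have hd : ∀ x : ℝ, HasDerivAt (fun x => -Real.exp (-(a + x) / 2))
      (1 / 2 * Real.exp (-(a + x) / 2)) x := fun x => by
    have h : HasDerivAt (fun x : ℝ => -(a + x) / 2) (-1 / 2) x :=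
      (((hasDerivAt_id x).const_add a).neg).div_const 2
    exact h.exp.neg.congr_deriv (by ring)
  have hlim : Filter.Tendsto (fun x => -Real.exp (-(a + x) / 2)) Filter.atTop (nhds 0) := by
    rw [← neg_zero]
    refine (Real.tendsto_exp_atBot.comp ?_).neg
    refine Filter.Tendsto.atBot_div_const two_pos (Filter.tendsto_neg_atTop_atBot.comp ?_)
    exact Filter.tendsto_atTop_add_const_left _ a Filter.tendsto_id
  have heq : Set.EqOn (fun x => 1 / 2 * Real.exp (-(a + x) / 2)) (twoRateDensity a)
      (Set.Ioi z) := fun x hx => by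
    have hx' : z < x := hx
    simp only [twoRateDensity]
    rw [if_neg (by linarith), if_neg (by linarith)]
  constructor
  · exact (integrableOn_Ioi_deriv_of_nonneg' (fun x _ => hd x) (fun x _ => by positivity)
      hlim).congr_fun heq measurableSet_Ioi
  · rw [← setIntegral_congr_fun measurableSet_Ioi heq,
      integral_Ioi_of_hasDerivAt_of_nonneg' (fun x _ => hd x) (fun x _ => by positivity) hlim]
    ring

lemma twoRateDensity_tail {a z : ℝ} (ha : 0 < a) (hz : 0 ≤ z) :
    IntegrableOn (twoRateDensity a) (Set.Ioi z) ∧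
      ∫ x in Set.Ioi z, twoRateDensity a x = twoRateTail a z := by
  unfold twoRateTail
  split_ifs with h
  · have heq : Set.EqOn (fun x => Real.exp (-x)) (twoRateDensity a) (Set.uIoo z a) := fun x hx => by
      rw [Set.uIoo_of_le h.le] at hx
      simp only [twoRateDensity]
      rw [if_neg (by linarith [hx.1]), if_pos hx.2]
    have hi : IntervalIntegrable (twoRateDensity a) volume z a :=
      (Continuous.intervalIntegrable (by fun_prop) _ _).congr_uIoo heq
    obtain ⟨hi', he'⟩ := twoRateDensity_tail_of_le ha le_rfl
    rw [← Set.Ioc_union_Ioi_eq_Ioi h.le]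
    have hi'' := (intervalIntegrable_iff_integrableOn_Ioc_of_le h.le).1 hi
    refine ⟨hi''.union hi', ?_⟩
    rw [setIntegral_union (Set.Ioc_disjoint_Ioi le_rfl) measurableSet_Ioi hi'' hi',
      ← intervalIntegral.integral_of_le h.le, ← intervalIntegral.integral_congr_uIoo heq, he']
    have : ∫ x in z..a, Real.exp (-x) = Real.exp (-z) - Real.exp (-a) := by
      rw [intervalIntegral.integral_comp_neg (fun x => Real.exp x), integral_exp]
    rw [this]
    ring_nf
  · exact twoRateDensity_tail_of_le ha (not_lt.1 h)

lemma integral_twoRateDensity {a : ℝ} (ha : 0 < a) :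
    Integrable (twoRateDensity a) ∧ ∫ x, twoRateDensity a x = 1 := by
  have h0 : ∀ x, x ∉ Set.Ioi (0 : ℝ) → twoRateDensity a x = 0 := fun x hx =>
    if_pos (not_lt.1 hx)
  obtain ⟨hi, he⟩ := twoRateDensity_tail ha le_rfl
  refine ⟨hi.integrable_of_forall_notMem_eq_zero h0, ?_⟩
  rw [← setIntegral_eq_integral_of_forall_compl_eq_zero h0, he]
  simp [twoRateTail, ha]

/-- The distribution with hazard rate `1` on `(0, a)` and `1/2` on `[a, ∞)`. -/
noncomputable def twoRate (a : ℝ) (ha : 0 < a) : ValueDist where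
  density := twoRateDensity a
  measurable_density := measurable_twoRateDensity a
  density_nonneg := twoRateDensity_nonneg a
  density_of_neg z hz := if_pos hz.le
  lintegral_density := by
    rw [← ofReal_integral_eq_lintegral_ofReal (integral_twoRateDensity ha).1
      (Filter.Eventually.of_forall (twoRateDensity_nonneg a)), (integral_twoRateDensity ha).2,
      ENNReal.ofReal_one]
  ordConnected_support := by
    have : Function.support (twoRateDensity a) = Set.Ioi 0 := by
      ext z
      simp only [Function.mem_support, twoRateDensity, Set.mem_Ioi]
      split_ifs with h1 h2
      · simpa using h1
      · simpa [Real.exp_ne_zero] using h1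
      · simpa [Real.exp_ne_zero] using h1
    rw [this]
    exact Set.ordConnected_Ioi

section TwoRate

variable {a : ℝ} (ha : 0 < a)

lemma twoRate_cdf_of_nonneg {z : ℝ} (hz : 0 ≤ z) :
    (twoRate a ha).cdf z = 1 - twoRateTail a z := by
  obtain ⟨hi, he⟩ := integral_twoRateDensity ha
  have := integral_add_compl (measurableSet_Iic (a := z)) hi
  rw [Set.compl_Iic, (twoRateDensity_tail ha hz).2, he] at this
  have h : (twoRate a ha).cdf z = ∫ x in Set.Iic z, twoRateDensity a x := rfl
  linarith

lemma twoRate_cdf_of_neg {z : ℝ} (hz : z ≤ 0) : (twoRate a ha).cdf z = 0 := by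
  refine setIntegral_eq_zero_of_forall_eq_zero fun x hx => ?_
  exact if_pos (le_trans hx hz)

lemma twoRate_cdf_lt_one (z : ℝ) : (twoRate a ha).cdf z < 1 := by
  rcases le_total z 0 with h | h
  · rw [twoRate_cdf_of_neg ha h]; exact one_pos
  · rw [twoRate_cdf_of_nonneg ha h, twoRateTail]
    split_ifs <;> simp [Real.exp_pos]

/-- The two branches of the tail meet at `a`, so the threshold `a` on values is the threshold `1 -
exp (-a)` on quantiles. -/
lemma twoRate_cdf_lt_iff {z : ℝ} : (twoRate a ha).cdf z < 1 - Real.exp (-a) ↔ z < a := by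
  rcases le_total z 0 with h | h
  · rw [twoRate_cdf_of_neg ha h]
    simp [ha, h.trans_lt ha]
  · rw [twoRate_cdf_of_nonneg ha h, twoRateTail]
    split_ifs with hz
    · simp [hz]
    · simp only [sub_lt_sub_iff_left, Real.exp_lt_exp, hz, iff_false, not_lt]
      linarith

/-- Strict positivity matters: the density vanishes at `0`, where the virtual value is a division by
zero. -/
lemma twoRate_quantile_of_lt {s : ℝ} (hs : 0 < s) (hs' : s < 1 - Real.exp (-a)) :
    (twoRate a ha).quantile s ∈ Set.Ioo 0 a := by
  have hs1 : 0 < 1 - s := by linarith [Real.exp_pos (-a)]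
  set t := -Real.log (1 - s) with ht
  have hexp : Real.exp (-t) = 1 - s := by rw [ht, neg_neg, Real.exp_log hs1]
  have ht0 : 0 < t := by
    have : Real.log (1 - s) < 0 := Real.log_neg hs1 (by linarith)
    linarith
  have hta : t < a := by
    have : Real.exp (-a) < Real.exp (-t) := by rw [hexp]; linarith
    linarith [Real.exp_lt_exp.1 this]
  have hleast : IsLeast {z : ℝ | s ≤ (twoRate a ha).cdf z} t := by
    constructor
    · simp only [Set.mem_ofPred_eq]
      rw [twoRate_cdf_of_nonneg ha ht0.le, twoRateTail, if_pos hta, hexp]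
      linarith
    · intro z hz
      simp only [Set.mem_ofPred_eq] at hz
      by_contra! hlt
      rcases le_total z 0 with h | h
      · rw [twoRate_cdf_of_neg ha h] at hz
        linarith
      · rw [twoRate_cdf_of_nonneg ha h, twoRateTail, if_pos (hlt.trans hta)] at hz
        have := Real.exp_lt_exp.2 (neg_lt_neg hlt)
        linarith
  rw [ValueDist.quantile, hleast.csInf_eq]
  exact ⟨ht0, hta⟩

lemma le_twoRate_quantile {s : ℝ} (hs : 1 - Real.exp (-a) ≤ s) (hs' : s < 1) :
    a ≤ (twoRate a ha).quantile s := by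
  refine le_csInf ?_ fun z hz => ?_
  · have hs1 : 0 < 1 - s := by linarith
    have hle : Real.log (1 - s) ≤ -a := by
      rw [← Real.log_exp (-a)]
      exact Real.log_le_log hs1 (by linarith)
    -- This solves `exp (-(a + z) / 2) = 1 - s`. A witness is needed because the infimum of the
    -- empty set is `0`.
    refine ⟨-2 * Real.log (1 - s) - a, ?_⟩
    simp only [Set.mem_ofPred_eq]
    rw [twoRate_cdf_of_nonneg ha (by linarith), twoRateTail, if_neg (by linarith)]
    ring_nf
    rw [Real.exp_log (by linarith)]
    linarith
  · by_contra! hlt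
    exact absurd ((twoRate_cdf_lt_iff ha).2 hlt) (not_lt.2 (hs.trans hz))

lemma twoRate_virtual_of_lt {z : ℝ} (hz : z ∈ Set.Ioo 0 a) : (twoRate a ha).virtual z = 1 := by
  have hd : (twoRate a ha).density z = Real.exp (-z) := by
    change twoRateDensity a z = _
    rw [twoRateDensity, if_neg hz.1.not_ge, if_pos hz.2]
  rw [ValueDist.virtual, twoRate_cdf_of_nonneg ha hz.1.le, hd, twoRateTail, if_pos hz.2,
    sub_sub_cancel, div_self (Real.exp_ne_zero _)]

lemma twoRate_virtual_of_le {z : ℝ} (hz : a ≤ z) : (twoRate a ha).virtual z = 2 := by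
  have hd : (twoRate a ha).density z = 1 / 2 * Real.exp (-(a + z) / 2) := by
    change twoRateDensity a z = _
    rw [twoRateDensity, if_neg (by linarith), if_neg (by linarith)]
  rw [ValueDist.virtual, twoRate_cdf_of_nonneg ha (by linarith), hd, twoRateTail,
    if_neg (by linarith), sub_sub_cancel]
  field_simp [Real.exp_ne_zero]

lemma twoRate_cumVirtual {q : ℝ} (hq : q ∈ Set.Ico (0 : ℝ) 1) :
    (twoRate a ha).cumVirtual q = max q (2 * q - (1 - Real.exp (-a))) := by
  have hqa : 0 < 1 - Real.exp (-a) := by simpa using ha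
  have := (integral_two_step (f := fun r => (twoRate a ha).virtual ((twoRate a ha).quantile r))
    -- Breaking at the minimum treats both sides of the kink at once; for small `q` the second
    -- interval is empty.
    (a := min q (1 - Real.exp (-a))) (t := q) (b := 1) (c := 2) (le_min hq.1 hqa.le)
    (min_le_left _ _) (fun r hr => ?_) fun r hr => ?_).2
  · rw [ValueDist.cumVirtual, this]
    rcases le_total q (1 - Real.exp (-a)) with h | h
    · rw [min_eq_left h, max_eq_left (by linarith)]; ring
    · rw [min_eq_right h, max_eq_right (by linarith)]; ring
  · exact twoRate_virtual_of_lt ha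
      (twoRate_quantile_of_lt ha hr.1 (hr.2.trans_le (min_le_right _ _)))
  · refine twoRate_virtual_of_le ha (le_twoRate_quantile ha ?_ (hr.2.trans hq.2))
    rcases min_lt_iff.1 hr.1 with h | h
    · exact (h.not_gt hr.2).elim
    · exact h.le

/-- The virtual value increases from `1` to `2`, so `H` is a maximum of two affine functions, hence
convex and its own hull. -/
lemma twoRate_hull {q : ℝ} (hq : q ∈ Set.Ico (0 : ℝ) 1) :
    (twoRate a ha).hull q = max q (2 * q - (1 - Real.exp (-a))) := by
  rw [ValueDist.hull_eq_cumVirtual _ ?_ hq, twoRate_cumVirtual ha hq]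
  have h : ConvexOn ℝ (Set.Ico (0 : ℝ) 1) fun q => max q (2 * q - (1 - Real.exp (-a))) := by
    refine (convexOn_id (convex_Ico 0 1)).sup ⟨convex_Ico 0 1, fun x _ y _ b c _ _ hbc => ?_⟩
    simp only [smul_eq_mul]
    refine le_of_eq ?_
    linear_combination (1 - Real.exp (-a)) * hbc
  exact h.congr fun q hq => (twoRate_cumVirtual ha hq).symm

/-- At the kink the right derivative selects the larger slope, so the value `a` itself counts as
high. -/
lemma twoRate_ironed (z : ℝ) : (twoRate a ha).ironed z = if z < a then 1 else 2 := by
  have hmem : (twoRate a ha).cdf z ∈ Set.Ico (0 : ℝ) 1 :=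
    ⟨ValueDist.cdf_nonneg _ z, twoRate_cdf_lt_one ha z⟩
  rw [ValueDist.ironed, ValueDist.hullDeriv_of_lt _ hmem.2, ValueDist.hullRightDeriv]
  set q := (twoRate a ha).cdf z with hq
  split_ifs with h
  · have hlt : q < 1 - Real.exp (-a) := (twoRate_cdf_lt_iff ha).2 h
    have hd : HasDerivWithinAt (twoRate a ha).hull 1 (Set.Ioi q) q := by
      refine (hasDerivWithinAt_id q _).congr_of_eventuallyEq ?_ ?_
      · filter_upwards [Ioo_mem_nhdsGT (lt_min hlt hmem.2)] with r hr
        have := lt_min_iff.1 hr.2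
        rw [twoRate_hull ha ⟨hmem.1.trans hr.1.le, this.2⟩, max_eq_left (by linarith)]
        rfl
      · rw [twoRate_hull ha hmem, max_eq_left (by linarith)]
        rfl
    rw [hd.derivWithin (uniqueDiffWithinAt_Ioi q)]
    rfl
  · have hge : 1 - Real.exp (-a) ≤ q := not_lt.1 (mt (twoRate_cdf_lt_iff ha).1 h)
    have hd : HasDerivWithinAt (twoRate a ha).hull 2 (Set.Ioi q) q := by
      have h2 : HasDerivWithinAt (fun r : ℝ => 2 * r - (1 - Real.exp (-a))) 2 (Set.Ioi q) q := by
        simpa using ((hasDerivWithinAt_id q (Set.Ioi q)).const_mul 2).sub_const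
          (1 - Real.exp (-a))
      refine h2.congr_of_eventuallyEq ?_ ?_
      · filter_upwards [Ioo_mem_nhdsGT hmem.2] with r hr
        rw [twoRate_hull ha ⟨hmem.1.trans hr.1.le, hr.2⟩, max_eq_right (by linarith [hr.1])]
      · rw [twoRate_hull ha hmem, max_eq_right (by linarith)]
    rw [hd.derivWithin (uniqueDiffWithinAt_Ioi q)]
    rfl

/-- If all values are below the threshold, then the unit is given away by a fair lottery. -/
lemma twoRate_optResidual_of_lt {v : Fin 2 → ℝ} (hv : IsProfile v) {i j : Fin 2} (hij : i ≠ j)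
    (hi : v i < a) (hj : v j < a) : (twoRate a ha).optResidual 2 1 v = (v i + v j) / 2 := by
  have key : ∀ i j : Fin 2, i ≠ j → v i < a → v j < a →
      ∫ z in (0 : ℝ)..(v i), (twoRate a ha).optAlloc 2 1 (Function.update v i z) i = v i / 2 := by
    intro i j hij hi hj
    rw [(integral_two_step (b := 1 / 2) (c := 0) (hv i) le_rfl (fun z hz => ?_)
      fun z hz => (hz.1.not_gt hz.2).elim).2]
    · ring
    · have hz' : z < a := hz.2.trans hi
      refine ValueDist.optAlloc_eq_half _ hij ?_ ?_
      · simp [hij.symm, twoRate_ironed, hz', hj]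
      · simp [twoRate_ironed, hz']
  rw [ValueDist.optResidual_two_one _ hij, key i j hij hi hj, key j i hij.symm hj hi]
  ring

/-- If the threshold separates the two values, then the larger value wins. -/
lemma twoRate_optResidual_of_lt_of_le {v : Fin 2 → ℝ} (hv : IsProfile v) {i j : Fin 2}
    (hij : i ≠ j) (hi : a ≤ v i) (hj : v j < a) :
    (twoRate a ha).optResidual 2 1 v = v i - a / 2 := by
  have h12 : (1 : EReal) < 2 := by norm_num
  rw [ValueDist.optResidual_two_one _ hij,
    (integral_two_step (b := 1 / 2) (c := 1) ha.le hi (fun z hz => ?_) fun z hz => ?_).2,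
    (integral_two_step (b := 0) (c := 0) (hv j) le_rfl (fun z hz => ?_)
      fun z hz => (hz.1.not_gt hz.2).elim).2]
  · ring
  · refine ValueDist.optAlloc_eq_zero (j := i) _ ?_
    simp [hij, twoRate_ironed, hz.2.trans hj, hi.not_gt, h12]
  · refine ValueDist.optAlloc_eq_half _ hij ?_ ?_
    · simp [hij.symm, twoRate_ironed, hz.2, hj]
    · simp [twoRate_ironed, hz.2]
  · refine ValueDist.optAlloc_eq_one (j := j) _ ?_
    simp [hij.symm, twoRate_ironed, hz.1.not_gt, hj, h12]

end TwoRate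

/-! ### The value of the benchmark for two agents and one unit. -/

lemma bddAbove_optResidual {v : Fin 2 → ℝ} (hv : IsProfile v) {i j : Fin 2} (hij : i ≠ j)
    (h : v j ≤ v i) : BddAbove (Set.range fun D : ValueDist => D.optResidual 2 1 v) :=
  ⟨_, by rintro _ ⟨D, rfl⟩; exact D.optResidual_le hv hij h⟩

lemma benchmark_eq_of_le {v : Fin 2 → ℝ} (hv : IsProfile v) {i j : Fin 2} (hij : i ≠ j)
    (h : v j ≤ v i) : benchmark 2 1 v = max ((v i + v j) / 2) (v i - v j / 2) := by
  have hne : Nonempty ValueDist := ⟨twoRate 1 one_pos⟩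
  have hbdd := bddAbove_optResidual hv hij h
  refine le_antisymm (ciSup_le fun D => D.optResidual_le hv hij h) ?_
  have hhalf : (v i + v j) / 2 ≤ benchmark 2 1 v := by
    have ha : 0 < v i + 1 := by linarith [hv i]
    rw [← twoRate_optResidual_of_lt ha hv hij (by linarith) (by linarith)]
    exact le_ciSup hbdd _
  refine max_le hhalf ?_
  rcases h.eq_or_lt with heq | hlt
  · linarith [hv i]
  by_contra! hcon
  -- The second term is approached as the threshold decreases to `v j`. A threshold in `(v j, v j +
  -- ε]`, capped by `v i`, loses at most `ε / 2`, less than the assumed gap `ε`.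
  set ε := v i - v j / 2 - benchmark 2 1 v with hε
  have hjm : v j < min (v i) (v j + ε) := lt_min hlt (by linarith)
  have ha : 0 < min (v i) (v j + ε) := (hv j).trans_lt hjm
  have hle : (twoRate _ ha).optResidual 2 1 v ≤ benchmark 2 1 v := le_ciSup hbdd _
  rw [twoRate_optResidual_of_lt_of_le ha hv hij (min_le_left _ _) hjm] at hle
  linarith [min_le_right (v i) (v j + ε)]

/-- The benchmark for two agents and one unit. -/
theorem benchmark_two_one {v : Fin 2 → ℝ} (hv : IsProfile v) :
    benchmark 2 1 v = max ((v 0 + v 1) / 2) (max (v 0) (v 1) - min (v 0) (v 1) / 2) := by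
  rcases le_total (v 1) (v 0) with h | h
  · rw [benchmark_eq_of_le hv (i := 0) (j := 1) (by decide) h, max_eq_left h, min_eq_right h]
  · rw [benchmark_eq_of_le hv (i := 1) (j := 0) (by decide) h, max_eq_right h, min_eq_left h,
      add_comm]

/-! ### The standard exponential distribution -/

instance : IsProbabilityMeasure (expMeasure 1) := isProbabilityMeasure_expMeasure one_pos

instance : IsProbabilityMeasure expPrior := by
  unfold expPrior; infer_instance

lemma expMeasure_one_eq : expMeasure 1 =
    (volume.restrict (Set.Ioi 0)).withDensity fun x => ENNReal.ofReal (Real.exp (-x)) := by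
  have h : expMeasure 1 = volume.withDensity (exponentialPDF 1) := rfl
  rw [h, restrict_Ioi_eq_restrict_Ici, ← withDensity_indicator measurableSet_Ici]
  congr 1
  ext x
  rw [exponentialPDF_eq]
  by_cases hx : 0 ≤ x <;> simp [hx]

lemma lintegral_expMeasure {f : ℝ → ENNReal} (hf : Measurable f) :
    ∫⁻ x, f x ∂expMeasure 1 = ∫⁻ x in Set.Ioi 0, ENNReal.ofReal (Real.exp (-x)) * f x := by
  rw [expMeasure_one_eq, lintegral_withDensity_eq_lintegral_mul _ (by fun_prop) hf]
  rfl

lemma integral_expMeasure (f : ℝ → ℝ) :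
    ∫ x, f x ∂expMeasure 1 = ∫ x in Set.Ioi 0, Real.exp (-x) * f x := by
  rw [expMeasure_one_eq, integral_withDensity_eq_integral_toReal_smul (by fun_prop)
    (Filter.Eventually.of_forall fun _ => ENNReal.ofReal_lt_top)]
  simp [ENNReal.toReal_ofReal (Real.exp_pos _).le]

lemma integrable_expMeasure {f : ℝ → ℝ}
    (h : IntegrableOn (fun x => Real.exp (-x) * f x) (Set.Ioi 0)) :
    Integrable f (expMeasure 1) := by
  rw [expMeasure_one_eq, integrable_withDensity_iff (by fun_prop)
    (Filter.Eventually.of_forall fun _ => ENNReal.ofReal_lt_top)]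
  refine h.congr (Filter.Eventually.of_forall fun x => ?_)
  simp only
  rw [ENNReal.toReal_ofReal (Real.exp_pos _).le, mul_comm]

lemma ae_expMeasure_pos : ∀ᵐ x ∂expMeasure 1, 0 < x := by
  rw [expMeasure_one_eq]
  exact (withDensity_absolutelyContinuous _ _).ae_le (ae_restrict_mem measurableSet_Ioi)

lemma expMeasure_Ici {t : ℝ} (ht : 0 ≤ t) :
    expMeasure 1 (Set.Ici t) = ENNReal.ofReal (Real.exp (-t)) := by
  rw [expMeasure_one_eq, withDensity_apply _ measurableSet_Ici,
    Measure.restrict_restrict measurableSet_Ici]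
  rw [setLIntegral_congr (t := Set.Ioi t), ← ofReal_integral_eq_lintegral_ofReal,
    integral_exp_neg_Ioi]
  · exact integrableOn_exp_neg_Ioi t
  · exact Filter.Eventually.of_forall fun x => (Real.exp_pos _).le
  · have : Set.Ioi t = Set.Ioi t ∩ Set.Ioi 0 :=
      (Set.inter_eq_left.2 (Set.Ioi_subset_Ioi ht)).symm
    rw [this]
    exact Ioi_ae_eq_Ici.symm.inter (Filter.EventuallyEq.refl _ _)

/-- The integrand vanishes up to `2 * b`; beyond it, `-((x / 2 - b + 1 / 2) * exp (-x))` is a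
primitive. The case `b = 0` also yields the mean of the exponential law. -/
lemma integral_exp_neg_mul_posPart {b : ℝ} (hb : 0 ≤ b) :
    IntegrableOn (fun x => Real.exp (-x) * max 0 (x / 2 - b)) (Set.Ioi 0) ∧
      ∫ x in Set.Ioi 0, Real.exp (-x) * max 0 (x / 2 - b) = Real.exp (-(2 * b)) / 2 := by
  have hd : ∀ x : ℝ, HasDerivAt (fun x => -((x / 2 - b + 1 / 2) * Real.exp (-x)))
      (Real.exp (-x) * (x / 2 - b)) x := fun x => by
    have h1 : HasDerivAt (fun x : ℝ => x / 2 - b + 1 / 2) (1 / 2) x :=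
      (((hasDerivAt_id x).div_const 2).sub_const b).add_const (1 / 2)
    have h2 : HasDerivAt (fun x : ℝ => Real.exp (-x)) (Real.exp (-x) * -1) x :=
      (hasDerivAt_neg x).exp
    exact (h1.mul h2).neg.congr_deriv (by ring)
  have hlim : Filter.Tendsto (fun x => -((x / 2 - b + 1 / 2) * Real.exp (-x))) Filter.atTop
      (nhds 0) := by
    have h1 := Real.tendsto_pow_mul_exp_neg_atTop_nhds_zero 1
    have h0 := Real.tendsto_pow_mul_exp_neg_atTop_nhds_zero 0
    have := ((h1.const_mul (1 / 2)).add (h0.const_mul (1 / 2 - b))).neg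
    simp only [mul_zero, add_zero, neg_zero] at this
    refine this.congr fun x => ?_
    ring
  have hpos : ∀ x ∈ Set.Ioi (2 * b), 0 ≤ Real.exp (-x) * (x / 2 - b) := fun x hx => by
    have : 2 * b < x := hx
    exact mul_nonneg (Real.exp_pos _).le (by linarith)
  have heq : Set.EqOn (fun x => Real.exp (-x) * (x / 2 - b))
      (fun x => Real.exp (-x) * max 0 (x / 2 - b)) (Set.Ioi (2 * b)) := fun x hx => by
    have : 2 * b < x := hx
    simp only
    rw [max_eq_right (by linarith)]
  have hzero : ∀ x ∈ Set.Ioi 0 \ Set.Ioi (2 * b), Real.exp (-x) * max 0 (x / 2 - b) = 0 := by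
    intro x hx
    have : x ≤ 2 * b := not_lt.1 hx.2
    rw [max_eq_left (by linarith), mul_zero]
  have hsub : Set.Ioi (2 * b) ⊆ Set.Ioi 0 := Set.Ioi_subset_Ioi (by linarith)
  constructor
  · refine IntegrableOn.of_forall_sdiff_eq_zero ?_ measurableSet_Ioi hzero
    exact (integrableOn_Ioi_deriv_of_nonneg' (fun x _ => hd x) hpos hlim).congr_fun heq
      measurableSet_Ioi
  · rw [setIntegral_eq_of_subset_of_forall_sdiff_eq_zero measurableSet_Ioi hsub hzero,
      ← setIntegral_congr_fun measurableSet_Ioi heq,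
      integral_Ioi_of_hasDerivAt_of_nonneg' (fun x _ => hd x) hpos hlim]
    ring_nf

lemma integral_expMeasure_posPart {b : ℝ} (hb : 0 ≤ b) :
    ∫ x, max 0 (x / 2 - b) ∂expMeasure 1 = Real.exp (-(2 * b)) / 2 := by
  rw [integral_expMeasure, (integral_exp_neg_mul_posPart hb).2]

lemma expMeasure_mean :
    Integrable (fun x => x) (expMeasure 1) ∧ ∫ x, x ∂expMeasure 1 = 1 := by
  have hae : (fun x => 2 * max 0 (x / 2 - 0)) =ᵐ[expMeasure 1] fun x => x := by
    filter_upwards [ae_expMeasure_pos] with x hx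
    rw [max_eq_right (by linarith)]
    ring
  constructor
  · refine Integrable.congr (Integrable.const_mul ?_ 2) hae
    exact integrable_expMeasure (integral_exp_neg_mul_posPart le_rfl).1
  · rw [← integral_congr_ae hae, integral_const_mul, integral_expMeasure_posPart le_rfl]
    simp

lemma integral_expMeasure_exp_neg_two_mul :
    ∫ x, Real.exp (-(2 * x)) / 2 ∂expMeasure 1 = 1 / 6 := by
  rw [integral_expMeasure]
  have : ∀ x : ℝ, Real.exp (-x) * (Real.exp (-(2 * x)) / 2) = 1 / 2 * Real.exp (-3 * x) := by
    intro x
    rw [← mul_div_assoc, ← Real.exp_add]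
    ring_nf
  simp_rw [this]
  rw [integral_const_mul, integral_exp_mul_Ioi (by norm_num)]
  norm_num

/-- For a standard exponential value, the primitive of `g` has the same mean as `g`. -/
lemma integral_expMeasure_primitive {g : ℝ → ℝ} (hg : Measurable g) (h0 : ∀ t, 0 ≤ g t)
    (h1 : ∀ t, g t ≤ 1) :
    Integrable (fun t => ∫ s in (0 : ℝ)..t, g s) (expMeasure 1) ∧
      ∫ t, (∫ s in (0 : ℝ)..t, g s) ∂expMeasure 1 = ∫ t, g t ∂expMeasure 1 := by
  have hint : ∀ a b, IntervalIntegrable g volume a b := fun a b =>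
    (intervalIntegrable_const (c := (1 : ℝ))).mono_fun hg.aestronglyMeasurable
      (Filter.Eventually.of_forall fun t => by simpa [abs_of_nonneg (h0 t)] using h1 t)
  have hcont : Continuous fun t => ∫ s in (0 : ℝ)..t, g s :=
    intervalIntegral.continuous_primitive hint 0
  have hnn : ∀ᵐ t ∂expMeasure 1, 0 ≤ ∫ s in (0 : ℝ)..t, g s := by
    filter_upwards [ae_expMeasure_pos] with t ht
    exact intervalIntegral.integral_nonneg ht.le fun s _ => h0 s
  constructor
  · refine expMeasure_mean.1.mono hcont.aestronglyMeasurable ?_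
    filter_upwards [ae_expMeasure_pos] with t ht
    have := intervalIntegral.norm_integral_le_of_norm_le_const (a := 0) (b := t) (C := 1)
      (f := g) fun s _ => by simpa [abs_of_nonneg (h0 s)] using h1 s
    simpa using this
  · rw [integral_eq_lintegral_of_nonneg_ae hnn hcont.aestronglyMeasurable,
      integral_eq_lintegral_of_nonneg_ae (Filter.Eventually.of_forall h0)
        hg.aestronglyMeasurable, lintegral_expMeasure (f := fun t => ENNReal.ofReal (g t))
        (by fun_prop)]
    -- Layer cake: the mean of the primitive is the integral of `g` against the tail `exp (-t)`,
    -- which for this law is also the density.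
    have := lintegral_comp_eq_lintegral_meas_le_mul (expMeasure 1) (f := fun t => t) (g := g)
      (ae_expMeasure_pos.mono fun _ h => h.le) aemeasurable_id (fun t _ => hint 0 t)
      (Filter.Eventually.of_forall h0)
    rw [this]
    congr 1
    refine setLIntegral_congr_fun measurableSet_Ioi fun t ht => ?_
    have ht' : (0 : ℝ) < t := ht
    have : expMeasure 1 {a | t ≤ a} = ENNReal.ofReal (Real.exp (-t)) := expMeasure_Ici ht'.le
    simp only [this]

/-! ### Resampling one coordinate of a product measure -/

/-- Interim quantities overwrite one coordinate of a full sample. Drawing the overwriting value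
independently from the same law restores the product measure, which lets Fubini link interim and ex
ante expectations. -/
lemma measurePreserving_update {ι : Type*} [Fintype ι] [DecidableEq ι] (μ : Measure ℝ)
    [IsProbabilityMeasure μ] (i : ι) :
    MeasurePreserving (fun p : ℝ × (ι → ℝ) => Function.update p.2 i p.1)
      (μ.prod (Measure.pi fun _ => μ)) (Measure.pi fun _ => μ) := by
  have hm : Measurable fun p : ℝ × (ι → ℝ) => Function.update p.2 i p.1 := by
    refine measurable_pi_lambda _ fun j => ?_
    by_cases h : j = i
    · subst h; simpa using measurable_fst
    · simp only [Function.update_of_ne h]; fun_prop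
  refine ⟨hm, (Measure.pi_eq fun s hs => ?_).symm⟩
  rw [Measure.map_apply hm (MeasurableSet.univ_pi hs)]
  -- The overwritten coordinate is unconstrained and contributes total mass `1`.
  have : (fun p : ℝ × (ι → ℝ) => Function.update p.2 i p.1) ⁻¹' Set.univ.pi s
      = s i ×ˢ Set.univ.pi (Function.update s i Set.univ) := by
    ext p
    simp only [Set.mem_preimage, Set.mem_pi, Set.mem_univ, true_imp_iff, Set.mem_prod]
    constructor
    · intro h
      refine ⟨by simpa using h i, fun j => ?_⟩
      by_cases hj : j = i
      · subst hj; simp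
      · simpa [hj] using h j
    · rintro ⟨h, h'⟩ j
      by_cases hj : j = i
      · subst hj; simpa using h
      · simpa [hj] using h' j
  rw [this, Measure.prod_prod, Measure.pi_pi, ← Finset.mul_prod_erase _ _ (Finset.mem_univ i),
    ← Finset.mul_prod_erase (Finset.univ) (fun j => μ (s j)) (Finset.mem_univ i)]
  simp only [Function.update_self, measure_univ, one_mul]
  congr 1
  refine Finset.prod_congr rfl fun j hj => ?_
  rw [Function.update_of_ne (Finset.ne_of_mem_erase hj)]

lemma integral_expPrior_update {g : (Fin 2 → ℝ) → ℝ} (hg : Integrable g expPrior) (i : Fin 2) :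
    Integrable (fun t => ∫ v, g (Function.update v i t) ∂expPrior) (expMeasure 1) ∧
      ∫ t, (∫ v, g (Function.update v i t) ∂expPrior) ∂expMeasure 1 = ∫ v, g v ∂expPrior := by
  have hp := measurePreserving_update (expMeasure 1) i
  have hi : Integrable (fun p : ℝ × (Fin 2 → ℝ) => g (Function.update p.2 i p.1))
      ((expMeasure 1).prod expPrior) := hp.integrable_comp_of_integrable hg
  refine ⟨hi.integral_prod_left, ?_⟩
  rw [← integral_prod _ hi]
  have h := hp.map_eq
  change _ = ∫ v, g v ∂(Measure.pi fun _ => expMeasure 1)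
  rw [← h, integral_map hp.measurable.aemeasurable (by rw [h]; exact hg.aestronglyMeasurable)]
  rfl

lemma integral_expPrior_eval {f : ℝ → ℝ} (hf : Measurable f) (i : Fin 2) :
    ∫ v, f (v i) ∂expPrior = ∫ x, f x ∂expMeasure 1 :=
  integral_comp_eval (μ := fun _ : Fin 2 => expMeasure 1) hf.aestronglyMeasurable

lemma integrable_expPrior_eval (i : Fin 2) : Integrable (fun v : Fin 2 → ℝ => v i) expPrior :=
  (measurePreserving_eval (fun _ : Fin 2 => expMeasure 1) i).integrable_comp_of_integrable
    expMeasure_mean.1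

lemma integral_expPrior_coord (i : Fin 2) : ∫ v, v i ∂expPrior = 1 :=
  (integral_expPrior_eval measurable_id i).trans expMeasure_mean.2

lemma ae_isProfile : ∀ᵐ v ∂expPrior, IsProfile v := by
  refine ae_all_iff.2 fun i => ?_
  exact (measurePreserving_eval (fun _ : Fin 2 => expMeasure 1) i).quasiMeasurePreserving.ae
    (ae_expMeasure_pos.mono fun _ h => h.le)

/-! ### The expected benchmark -/

lemma integrable_expPrior_posPart (i j : Fin 2) :
    Integrable (fun v : Fin 2 → ℝ => max 0 (v i / 2 - v j)) expPrior :=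
  (integrable_zero _ _ _).sup
    (((integrable_expPrior_eval i).div_const 2).sub (integrable_expPrior_eval j))

lemma integral_expPrior_posPart {i j : Fin 2} (hij : i ≠ j) :
    ∫ v, max 0 (v i / 2 - v j) ∂expPrior = 1 / 6 := by
  rw [← (integral_expPrior_update (integrable_expPrior_posPart i j) j).2,
    ← integral_expMeasure_exp_neg_two_mul]
  refine integral_congr_ae ?_
  filter_upwards [ae_expMeasure_pos] with t ht
  simp only [Function.update_self, Function.update_of_ne hij]
  rw [integral_expPrior_eval (f := fun x => max 0 (x / 2 - t)) (by fun_prop),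
    integral_expMeasure_posPart ht.le]

/-- For `v j ≤ v i` the second term of the benchmark exceeds the lottery surplus by `v i / 2 - v j`,
while `v j / 2 - v i` is not positive. Thus at most one positive part is active. -/
lemma benchmark_ae_eq : benchmark 2 1 =ᵐ[expPrior] fun v =>
    (v 0 + v 1) / 2 + max 0 (v 0 / 2 - v 1) + max 0 (v 1 / 2 - v 0) := by
  filter_upwards [ae_isProfile] with v hv
  have h0 := hv 0
  have h1 := hv 1
  rw [benchmark_two_one hv]
  rcases le_total (v 1) (v 0) with h | h
  · rw [max_eq_left h, min_eq_right h, max_eq_left (a := 0) (b := v 1 / 2 - v 0) (by linarith)]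
    rw [← max_add_add_left, add_zero, add_zero]
    ring_nf
  · rw [max_eq_right h, min_eq_left h, max_eq_left (a := 0) (b := v 0 / 2 - v 1) (by linarith)]
    rw [add_zero, ← max_add_add_left, add_zero]
    ring_nf

theorem integral_benchmark :
    Integrable (benchmark 2 1) expPrior ∧ ∫ v, benchmark 2 1 v ∂expPrior = 4 / 3 := by
  have hs : Integrable (fun v : Fin 2 → ℝ => (v 0 + v 1) / 2) expPrior :=
    ((integrable_expPrior_eval 0).add (integrable_expPrior_eval 1)).div_const 2
  have hp := integrable_expPrior_posPart 0 1
  have hp' := integrable_expPrior_posPart 1 0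
  have hsp : Integrable (fun v : Fin 2 → ℝ => (v 0 + v 1) / 2 + max 0 (v 0 / 2 - v 1)) expPrior :=
    hs.add hp
  refine ⟨(hsp.add hp').congr benchmark_ae_eq.symm, ?_⟩
  rw [integral_congr_ae benchmark_ae_eq, integral_add hsp hp', integral_add hs hp,
    integral_div, integral_add (integrable_expPrior_eval 0) (integrable_expPrior_eval 1),
    integral_expPrior_coord, integral_expPrior_coord, integral_expPrior_posPart (by decide),
    integral_expPrior_posPart (by decide)]
  norm_num

/-! ### Bayesian mechanisms for exponential valuations -/

/-- A function whose increments are of second order does not increase. -/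
lemma le_of_sub_le_mul_sub {Φ X : ℝ → ℝ}
    (h : ∀ s r, 0 ≤ s → s ≤ r → Φ r - Φ s ≤ (r - s) * (X r - X s)) {t : ℝ} (ht : 0 ≤ t) :
    Φ t ≤ Φ 0 := by
  -- On an equal partition the increments of `X` telescope, leaving a single factor `δ` that tends
  -- to `0` under refinement.
  have hstep : ∀ δ : ℝ, 0 ≤ δ → ∀ j : ℕ, Φ (j * δ) ≤ Φ 0 + δ * (X (j * δ) - X 0) := by
    intro δ hδ j
    induction j with
    | zero => simp
    | succ j ih =>
      have hle : (j : ℝ) * δ ≤ (j + 1 : ℕ) * δ := by gcongr; simp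
      have := h (j * δ) ((j + 1 : ℕ) * δ) (by positivity) hle
      have hd : ((j + 1 : ℕ) : ℝ) * δ - j * δ = δ := by push_cast; ring
      rw [hd] at this
      linarith
  have hlim : Filter.Tendsto (fun n : ℕ => Φ 0 + 1 / ((n : ℝ) + 1) * (t * (X t - X 0)))
      Filter.atTop (nhds (Φ 0 + 0 * (t * (X t - X 0)))) :=
    (tendsto_one_div_add_atTop_nhds_zero_nat.mul_const _).const_add _
  rw [zero_mul, add_zero] at hlim
  refine ge_of_tendsto' hlim fun n => ?_
  have hn : ((n : ℝ) + 1) ≠ 0 := by positivity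
  have := hstep (t / (n + 1)) (by positivity) (n + 1)
  have ht' : ((n + 1 : ℕ) : ℝ) * (t / (n + 1)) = t := by push_cast; field_simp
  rw [ht'] at this
  refine this.trans (le_of_eq ?_)
  ring

/-- The envelope bound: with incentive compatibility, the utility of type `t` is at most the utility
of the lowest type plus the integral of the allocation. -/
lemma utility_le_integral_alloc {X P : ℝ → ℝ}
    (hic : ∀ t b, 0 ≤ t → 0 ≤ b → t * X b - P b ≤ t * X t - P t) (hP : 0 ≤ P 0)
    {t : ℝ} (ht : 0 ≤ t) : t * X t - P t ≤ ∫ s in (0 : ℝ)..t, X s := by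
  have hmono : MonotoneOn X (Set.Ici 0) := by
    intro s hs r hr hsr
    rcases hsr.eq_or_lt with rfl | hlt
    · rfl
    · have h1 := hic s r hs hr
      have h2 := hic r s hr hs
      by_contra! hX
      nlinarith [mul_pos (sub_pos.2 hlt) (sub_pos.2 hX)]
  have hint : ∀ a b, 0 ≤ a → 0 ≤ b → IntervalIntegrable X volume a b := fun a b ha hb =>
    (hmono.mono fun x hx => (le_min ha hb).trans hx.1).intervalIntegrable
  have key := le_of_sub_le_mul_sub
    (Φ := fun t => t * X t - P t - ∫ s in (0 : ℝ)..t, X s) (X := X) ?_ ht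
  · simp only [intervalIntegral.integral_same] at key
    linarith
  -- Type `s` imitating `r` shows that utility grows by at most `(r - s) * X r`, and monotonicity
  -- shows that the integral grows by at least `(r - s) * X s`.
  · intro s r hs hsr
    have hr := hs.trans hsr
    have h1 := hic s r hs hr
    have hsplit := intervalIntegral.integral_interval_sub_left (hint 0 r le_rfl hr)
      (hint 0 s le_rfl hs)
    have hlow : (r - s) * X s ≤ ∫ z in s..r, X z := by
      have : ∫ _ in s..r, X s = (r - s) * X s := by simp
      rw [← this]
      exact intervalIntegral.integral_mono_on hsr intervalIntegrable_const (hint s r hs hr)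
        fun z hz => hmono hs (hs.trans hz.1) hz.1
    linarith

namespace Mechanism

variable {M : Mechanism 2 1}

lemma measurable_update_apply {n : ℕ} (i : Fin n) (b : ℝ) :
    Measurable fun v : Fin n → ℝ => Function.update v i b :=
  measurable_pi_lambda _ fun j => by
    by_cases h : j = i
    · subst h; simp
    · simpa only [Function.update_of_ne h] using measurable_pi_apply j

lemma integrable_of_measurable_of_le {n : ℕ} {f : (Fin n → ℝ) → ℝ} {μ : Measure (Fin n → ℝ)}
    [IsFiniteMeasure μ] (hf : Measurable f) (h0 : ∀ᵐ v ∂μ, 0 ≤ f v) {c : ℝ}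
    (hc : ∀ᵐ v ∂μ, f v ≤ c) : Integrable f μ := by
  refine (integrable_const c).mono' hf.aestronglyMeasurable ?_
  filter_upwards [h0, hc] with v h0 hc
  rwa [Real.norm_eq_abs, abs_of_nonneg h0]

lemma integrable_alloc (M : Mechanism 2 1) (i : Fin 2) :
    Integrable (fun v => M.alloc v i) expPrior :=
  integrable_of_measurable_of_le (M.measurable_alloc i)
    (Filter.Eventually.of_forall fun v => M.alloc_nonneg v i)
    (Filter.Eventually.of_forall fun v => M.alloc_le_one v i)

lemma integrable_alloc_update (M : Mechanism 2 1) (i : Fin 2) (b : ℝ) :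
    Integrable (fun v => M.alloc (Function.update v i b) i) expPrior :=
  integrable_of_measurable_of_le ((M.measurable_alloc i).comp (measurable_update_apply i b))
    (Filter.Eventually.of_forall fun _ => M.alloc_nonneg _ i)
    (Filter.Eventually.of_forall fun _ => M.alloc_le_one _ i)

lemma integrable_value_mul_alloc (M : Mechanism 2 1) (i : Fin 2) :
    Integrable (fun v => v i * M.alloc v i) expPrior := by
  refine (integrable_expPrior_eval i).mono
    ((measurable_pi_apply i).mul (M.measurable_alloc i)).aestronglyMeasurable
    (Filter.Eventually.of_forall fun v => ?_)
  rw [norm_mul]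
  refine mul_le_of_le_one_right (norm_nonneg _) ?_
  rw [Real.norm_eq_abs, abs_of_nonneg (M.alloc_nonneg v i)]
  exact M.alloc_le_one v i

/-- The expected utility of an agent is at most the probability that it is served. -/
lemma IsBayesian.integral_utility_le (hM : M.IsBayesian expPrior) (i : Fin 2)
    (hpay : Integrable (fun v => M.pay v i) expPrior) :
    ∫ v, (v i * M.alloc v i - M.pay v i) ∂expPrior ≤ ∫ v, M.alloc v i ∂expPrior := by
  have hu := integral_expPrior_update ((M.integrable_value_mul_alloc i).sub hpay) i
  have hx := integral_expPrior_update (M.integrable_alloc i) i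
  have hmeas : Measurable (M.interimAlloc expPrior i) := by
    have hm : Measurable fun p : ℝ × (Fin 2 → ℝ) => M.alloc (Function.update p.2 i p.1) i :=
      (M.measurable_alloc i).comp (measurePreserving_update (expMeasure 1) i).measurable
    exact (hm.stronglyMeasurable.integral_prod_right (ν := expPrior)).measurable
  have hprim := integral_expMeasure_primitive hmeas
    (fun t => integral_nonneg fun v => M.alloc_nonneg _ i) fun t => by
      have := integral_mono (M.integrable_alloc_update i t) (integrable_const (1 : ℝ))
        fun v => M.alloc_le_one (Function.update v i t) i
      simpa [interimAlloc] using this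
  have hx2 : ∫ t, M.interimAlloc expPrior i t ∂expMeasure 1 = ∫ v, M.alloc v i ∂expPrior := hx.2
  have hu2 : _ = ∫ v, (v i * M.alloc v i - M.pay v i) ∂expPrior := hu.2
  -- The mean interim allocation is traded for the mean of its primitive, so the envelope bound can
  -- be applied type by type.
  rw [← hx2, ← hprim.2, ← hu2]
  refine integral_mono_ae hu.1 hprim.1 ?_
  filter_upwards [ae_expMeasure_pos] with t ht
  have hsub : ∫ v, (Function.update v i t i * M.alloc (Function.update v i t) i
      - M.pay (Function.update v i t) i) ∂expPrior =
      t * M.interimAlloc expPrior i t - M.interimPay expPrior i t := by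
    simp only [Function.update_self]
    rw [integral_sub ((M.integrable_alloc_update i t).const_mul t) (hM.1 i t ht.le),
      integral_const_mul]
    rfl
  refine hsub.le.trans (utility_le_integral_alloc (hM.2.1 i) ?_ ht.le)
  exact integral_nonneg fun v => M.pay_nonneg _ i

/-- No Bayesian mechanism has expected residual surplus larger than `1`. -/
lemma IsBayesian.integral_residual_le_one (hM : M.IsBayesian expPrior) :
    ∫ v, M.residual v ∂expPrior ≤ 1 := by
  -- A non-integrable residual has Bochner integral `0`, within the bound.
  by_cases hint : Integrable M.residual expPrior
  swap
  · rw [integral_undef hint]; exact zero_le_one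
  -- `IsBayesian` controls payments only bid by bid. Here each payment is dominated by the total
  -- payment, which is total allocated value minus residual.
  have hpay : ∀ i, Integrable (fun v => M.pay v i) expPrior := fun i => by
    refine Integrable.mono' (((M.integrable_value_mul_alloc 0).add
      (M.integrable_value_mul_alloc 1)).sub hint) (M.measurable_pay i).aestronglyMeasurable
      (Filter.Eventually.of_forall fun v => ?_)
    have h0 := M.pay_nonneg v 0
    have h1 := M.pay_nonneg v 1
    rw [Real.norm_eq_abs, abs_of_nonneg (M.pay_nonneg v i)]
    simp only [Pi.sub_apply, Pi.add_apply, residual, Fin.sum_univ_two]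
    fin_cases i <;> simp only [Fin.zero_eta, Fin.mk_one] <;> linarith
  have hu : ∀ i ∈ Finset.univ,
      Integrable (fun v => v i * M.alloc v i - M.pay v i) expPrior := fun i _ =>
    (M.integrable_value_mul_alloc i).sub (hpay i)
  calc ∫ v, M.residual v ∂expPrior
      = ∑ i, ∫ v, (v i * M.alloc v i - M.pay v i) ∂expPrior := integral_finsetSum _ hu
    _ ≤ ∑ i, ∫ v, M.alloc v i ∂expPrior :=
        Finset.sum_le_sum fun i _ => hM.integral_utility_le i (hpay i)
    _ = ∫ v, ∑ i, M.alloc v i ∂expPrior :=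
        (integral_finsetSum _ fun i _ => M.integrable_alloc i).symm
    _ ≤ ∫ _, (1 : ℝ) ∂expPrior := by
        refine integral_mono (integrable_finsetSum _ fun i _ => M.integrable_alloc i)
          (integrable_const _) fun v => ?_
        simpa using M.sum_alloc_le v
    _ = 1 := by simp

/-! ### From prior-free to Bayesian mechanisms, the factor `4/3`, and the fair lottery. -/

lemma isProfile_update {n : ℕ} {v : Fin n → ℝ} (hv : IsProfile v) (i : Fin n) {b : ℝ}
    (hb : 0 ≤ b) : IsProfile (Function.update v i b) := fun j => by
  by_cases h : j = i
  · subst h; simpa using hb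
  · simpa [h] using hv j

/-- A prior-free mechanism is Bayesian incentive compatible and individually rational. -/
lemma IsPriorFree.isBayesian (hM : M.IsPriorFree) : M.IsBayesian expPrior := by
  have hpay : ∀ i, ∀ b : ℝ, 0 ≤ b →
      Integrable (fun v => M.pay (Function.update v i b) i) expPrior := by
    intro i b hb
    -- Individual rationality at bid `b` caps the payment by `b` times a probability.
    refine integrable_of_measurable_of_le (c := b)
      ((M.measurable_pay i).comp (measurable_update_apply i b))
      (Filter.Eventually.of_forall fun v => M.pay_nonneg _ i) ?_
    filter_upwards [ae_isProfile] with v hv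
    have := hM.2 _ (isProfile_update hv i hb) i
    rw [Function.update_self] at this
    have := mul_le_of_le_one_right hb (M.alloc_le_one (Function.update v i b) i)
    linarith
  have hutil : ∀ i, ∀ t b : ℝ, 0 ≤ b → t * M.interimAlloc expPrior i b -
      M.interimPay expPrior i b = ∫ v, (t * M.alloc (Function.update v i b) i -
        M.pay (Function.update v i b) i) ∂expPrior := by
    intro i t b hb
    rw [integral_sub ((M.integrable_alloc_update i b).const_mul t) (hpay i b hb),
      integral_const_mul]
    rfl
  refine ⟨hpay, fun i t b ht hb => ?_, fun i t ht => ?_⟩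
  · rw [hutil i t b hb, hutil i t t ht]
    refine integral_mono_ae (((M.integrable_alloc_update i b).const_mul t).sub (hpay i b hb))
      (((M.integrable_alloc_update i t).const_mul t).sub (hpay i t ht)) ?_
    filter_upwards [ae_isProfile] with v hv
    simpa using hM.1 _ (isProfile_update hv i ht) i b hb
  · rw [hutil i t t ht]
    refine integral_nonneg_of_ae ?_
    filter_upwards [ae_isProfile] with v hv
    simpa using hM.2 _ (isProfile_update hv i ht) i

lemma IsPriorFree.integrable_residual (hM : M.IsPriorFree) :
    Integrable M.residual expPrior := by
  refine integrable_finsetSum _ fun i _ => (M.integrable_value_mul_alloc i).sub ?_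
  refine (M.integrable_value_mul_alloc i).mono' (M.measurable_pay i).aestronglyMeasurable ?_
  filter_upwards [ae_isProfile] with v hv
  rw [Real.norm_eq_abs, abs_of_nonneg (M.pay_nonneg v i)]
  exact sub_nonneg.1 (hM.2 v hv i)

/-- No prior-free mechanism approximates the benchmark within a factor smaller than `4/3`. -/
theorem IsPriorFree.four_thirds_le {β : ℝ} (hM : M.IsPriorFree) (hβ : M.Approximates β) :
    4 / 3 ≤ β := by
  -- Averaging the pointwise guarantee over the prior leaves `(4 / 3) / β ≤ 1`.
  have hle : ∫ v, benchmark 2 1 v / β ∂expPrior ≤ ∫ v, M.residual v ∂expPrior := by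
    refine integral_mono_ae (integral_benchmark.1.div_const β) hM.integrable_residual ?_
    filter_upwards [ae_isProfile] with v hv using hβ.2 v hv
  rw [integral_div, integral_benchmark.2] at hle
  exact (div_le_one hβ.1).1 (hle.trans hM.isBayesian.integral_residual_le_one)

/-- The lottery that serves each of the two agents with probability `1/2`, without payments. -/
noncomputable def fairLottery : Mechanism 2 1 where
  alloc _ _ := 1 / 2
  pay _ _ := 0
  measurable_alloc _ := measurable_const
  measurable_pay _ := measurable_const
  alloc_nonneg _ _ := by norm_num
  alloc_le_one _ _ := by norm_num
  sum_alloc_le _ := by norm_num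
  pay_nonneg _ _ := le_rfl

lemma fairLottery_isBayesian : fairLottery.IsBayesian expPrior := by
  refine ⟨fun i b _ => integrable_zero _ _ _, fun i t b _ _ => le_rfl, fun i t ht => ?_⟩
  simpa [interimAlloc, interimPay, fairLottery] using ht

lemma integral_fairLottery_residual : ∫ v, fairLottery.residual v ∂expPrior = 1 := by
  have h : ∀ v, fairLottery.residual v = (v 0 + v 1) * (1 / 2) := fun v => by
    simp [residual, fairLottery, add_mul]
  simp_rw [h]
  rw [integral_mul_const, integral_add (integrable_expPrior_eval 0) (integrable_expPrior_eval 1),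
    integral_expPrior_coord, integral_expPrior_coord]
  norm_num

end Mechanism

end MoneyBurning

open MoneyBurning MeasureTheory in
theorem mainTheorem7 :
    -- no prior-free mechanism for two agents and one unit beats the factor `4/3`
    (∀ (M : Mechanism 2 1) (β : ℝ), M.IsPriorFree → M.Approximates β → 4 / 3 ≤ β) ∧
    -- the optimal expected residual surplus for two i.i.d. standard exponential valuations is `1`
    IsGreatest {r : ℝ | ∃ M : Mechanism 2 1, M.IsBayesian expPrior ∧
      r = ∫ v, M.residual v ∂expPrior} 1 ∧
    -- the benchmark on a profile with larger value `max` and smaller value `min`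
    (∀ v : Fin 2 → ℝ, IsProfile v →
      benchmark 2 1 v = max ((v 0 + v 1) / 2) (max (v 0) (v 1) - min (v 0) (v 1) / 2)) ∧
    -- the expected benchmark for two i.i.d. standard exponential valuations is `4/3`
    (Integrable (benchmark 2 1) expPrior ∧ ∫ v, benchmark 2 1 v ∂expPrior = 4 / 3) := by
  refine ⟨fun M β hM hβ => hM.four_thirds_le hβ, ⟨?_, ?_⟩, fun v hv => benchmark_two_one hv,
    integral_benchmark⟩
  · exact ⟨Mechanism.fairLottery, Mechanism.fairLottery_isBayesian,
      Mechanism.integral_fairLottery_residual.symm⟩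
  · rintro _ ⟨M, hM, rfl⟩
    exact hM.integral_residual_le_one
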